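/- Let $k$ be a field and let $\alpha \in k^\times$ be an element of infinite multiplicative order. Let $S = k[x_1,\dots,x_5]_{(x_1,\dots,x_5)}$, and let $R = S/I$, where $I$ is the ideal $$I = (x_1^2,\ x_2^2,\ x_3x_4,\ x_3x_5,\ x_4x_5,\ x_5^2,\ \alpha x_1x_3+x_2x_3,\ x_1x_4+x_2x_4,\ x_3^2-x_2x_5+\alpha x_1x_5,\ x_4^2-x_2x_5+x_1x_5).$$ For a finitely generated module $N$ over a Noetherian local ring $A$ with minimal free resolution $(F,d)$, let $\mathbf{I}^1_i(N) \subseteq A$ denote the ideal of $1\times 1$ minors (that is, of the entries) of a matrix of $d_i : F_i \to F_{i-1}$ for $i \ge 0$, where $F_{-1}=0$, with the convention that this ideal is $A$ if $F_i = 0$ or $F_{i-1} = 0$; it does not depend on the choice of $F$. Then $R$ is an Artinian Gorenstein local ring, and there is a finitely generated $R$-module $M$ such that 1. $\mathbf{I}^1_i(M) \ne \mathbf{I}^1_{i+n}(M)$ for all $i \ge 0$ and $n \ge 1$; and 2. over the ring $R/(x_5)$, $\mathbf{I}^1_i(M/x_5M) \ne \mathbf{I}^1_{i+n}(M/x_5M)$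 for all $i \ge 0$ and $n \ge 1$. -/

import Mathlib

open scoped Pointwise

universe u

noncomputable section

/-- The ideal `I^r(A)` generated by the `r × r` minors of an `m × n` matrix `A`, viewed as a map
`R^n → R^m` of finite free modules.  By convention it is the unit ideal if the source or the target
of the map is `0`; otherwise it is `0` as soon as `r` exceeds `m` or `n` (there are then no minors
at all, since there is no embedding of `Fin r`). -/
def minorsIdeal {R : Type*} [CommRing R] {m n : ℕ} (r : ℕ) (A : Matrix (Fin m) (Fin n) R) :
    Ideal R :=
  if m = 0 ∨ n = 0 then ⊤
  else Ideal.span {a | ∃ (f : Fin r ↪ Fin m) (g : Fin r ↪ Fin n), a = (A.submatrix f g).det}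

/-- A minimal free resolution `⋯ → F₂ → F₁ → F₀ → M → 0` of a module `M` over a local ring `R`
by finite free modules, each given with a basis: `Fᵢ = R ^ rank i`, and the differential
`Fᵢ₊₁ → Fᵢ` is the matrix `mat i`.  Minimality says that all matrices have entries in the maximal
ideal. -/
structure MinimalFreeResolution (R : Type*) [CommRing R] [IsLocalRing R]
    (M : Type*) [AddCommGroup M] [Module R M] where
  rank : ℕ → ℕ
  mat : ∀ i : ℕ, Matrix (Fin (rank i)) (Fin (rank (i + 1))) R
  augmentation : (Fin (rank 0) → R) →ₗ[R] M
  augmentation_surjective : Function.Surjective augmentation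
  exact_zero : Function.Exact (mat 0).mulVecLin augmentation
  exact_succ : ∀ i, Function.Exact (mat (i + 1)).mulVecLin (mat i).mulVecLin
  minimal : ∀ i a b, mat i a b ∈ IsLocalRing.maximalIdeal R

/-- The ideal `I^r_i(F)` of `r × r` minors of the differential `d_i : F_i → F_{i-1}`, for `i ≥ 0`,
where `F_{-1} = 0`. -/
def MinimalFreeResolution.minors {R : Type*} [CommRing R] [IsLocalRing R]
    {M : Type*} [AddCommGroup M] [Module R M] (F : MinimalFreeResolution R M) (r : ℕ) :
    ℕ → Ideal R
  | 0 => minorsIdeal r (0 : Matrix (Fin 0) (Fin (F.rank 0)) R)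
  | i + 1 => minorsIdeal r (F.mat i)

/-- A Gorenstein local ring: a Noetherian local ring that has finite injective dimension as a
module over itself. -/
structure IsGorensteinLocalRing (R : Type*) [CommRing R] : Prop where
  isLocalRing : IsLocalRing R
  isNoetherianRing : IsNoetherianRing R
  finite_injectiveDimension :
    ∃ n : ℕ, CategoryTheory.HasInjectiveDimensionLE (ModuleCat.of R R) n

namespace GasharovPeeva

open MvPolynomial

variable (k : Type*) [Field k]

theorem mem_idealOfVars_iff (p : MvPolynomial (Fin 5) k) :
    p ∈ idealOfVars (Fin 5) k ↔ constantCoeff p = 0 := by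
  have h := mem_pow_idealOfVars_iff' (σ := Fin 5) (R := k) 1 p
  rw [pow_one] at h
  rw [h]
  constructor
  · intro h
    exact h 0 (by simp)
  · intro h x hx
    have hx0 : x = 0 := by
      simpa [Nat.lt_one_iff, Finsupp.degree_eq_zero_iff] using hx
    subst hx0
    exact h

instance isPrime_idealOfVars : (idealOfVars (Fin 5) k).IsPrime := by
  have h : idealOfVars (Fin 5) k = RingHom.ker (constantCoeff (σ := Fin 5) (R := k)) := by
    ext p
    rw [mem_idealOfVars_iff, RingHom.mem_ker]
  rw [h]
  exact RingHom.ker_isPrime _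

/-- The regular local ring `S = k[x₁, …, x₅]_{(x₁, …, x₅)}`. -/
abbrev S : Type _ := Localization.AtPrime (idealOfVars (Fin 5) k)

variable {k}

/-- The variables of `S`; the variable usually written `xⱼ` is `x (j - 1)`. -/
def x (j : Fin 5) : S k := algebraMap (MvPolynomial (Fin 5) k) (S k) (X j)

theorem x_mem_maximalIdeal (j : Fin 5) : (x j : S k) ∈ IsLocalRing.maximalIdeal (S k) :=
  (IsLocalization.AtPrime.to_map_mem_maximal_iff (S k) (idealOfVars (Fin 5) k) (X j)).2
    (Ideal.subset_span ⟨j, rfl⟩)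

/-- The ideal of quadrics defining the Gasharov–Peeva ring, generated by
`x₁², x₂², x₃x₄, x₃x₅, x₄x₅, x₅², αx₁x₃ + x₂x₃, x₁x₄ + x₂x₄, x₃² - x₂x₅ + αx₁x₅,
x₄² - x₂x₅ + x₁x₅`. -/
def quadricIdeal (α : k) : Ideal (S k) :=
  let x₁ : S k := x 0
  let x₂ : S k := x 1
  let x₃ : S k := x 2
  let x₄ : S k := x 3
  let x₅ : S k := x 4
  Ideal.span {x₁ ^ 2, x₂ ^ 2, x₃ * x₄, x₃ * x₅, x₄ * x₅, x₅ ^ 2,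
    algebraMap k (S k) α * x₁ * x₃ + x₂ * x₃, x₁ * x₄ + x₂ * x₄,
    x₃ ^ 2 - x₂ * x₅ + algebraMap k (S k) α * x₁ * x₅, x₄ ^ 2 - x₂ * x₅ + x₁ * x₅}

theorem quadricIdeal_le (α : k) : quadricIdeal α ≤ IsLocalRing.maximalIdeal (S k) := by
  have h := x_mem_maximalIdeal (k := k)
  have hl : ∀ (a : S k) (j : Fin 5), a * x j ∈ IsLocalRing.maximalIdeal (S k) :=
    fun a j => Ideal.mul_mem_left _ a (h j)
  refine Ideal.span_le.2 ?_
  rintro a (rfl | rfl | rfl | rfl | rfl | rfl | rfl | rfl | rfl | rfl)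
  · exact Ideal.pow_mem_of_mem _ (h _) 2 (by norm_num)
  · exact Ideal.pow_mem_of_mem _ (h _) 2 (by norm_num)
  · exact hl _ _
  · exact hl _ _
  · exact hl _ _
  · exact Ideal.pow_mem_of_mem _ (h _) 2 (by norm_num)
  · exact add_mem (hl _ _) (hl _ _)
  · exact add_mem (hl _ _) (hl _ _)
  · exact add_mem (sub_mem (Ideal.pow_mem_of_mem _ (h _) 2 (by norm_num)) (hl _ _)) (hl _ _)
  · exact add_mem (sub_mem (Ideal.pow_mem_of_mem _ (h _) 2 (by norm_num)) (hl _ _)) (hl _ _)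

theorem isLocalRing_quotient {A : Type*} [CommRing A] [IsLocalRing A] {J : Ideal A}
    (hJ : J ≤ IsLocalRing.maximalIdeal A) : IsLocalRing (A ⧸ J) := by
  have : Nontrivial (A ⧸ J) := Ideal.Quotient.nontrivial_iff.2 fun h =>
    (IsLocalRing.maximalIdeal.isMaximal A).ne_top (top_le_iff.1 (h ▸ hJ))
  exact IsLocalRing.of_surjective' (Ideal.Quotient.mk J) Ideal.Quotient.mk_surjective

/-- The Gasharov–Peeva ring `R = S / I`. -/
def R (α : k) : Type _ := S k ⧸ quadricIdeal α

instance commRing_R (α : k) : CommRing (R α) :=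
  inferInstanceAs (CommRing (S k ⧸ quadricIdeal α))

instance isLocalRing_R (α : k) : IsLocalRing (R α) :=
  isLocalRing_quotient (quadricIdeal_le α)

/-- The quotient map `S → R`. -/
def toR (α : k) : S k →+* R α := Ideal.Quotient.mk (quadricIdeal α)

/-- The image of `x₅` in `R`. -/
def x₅ (α : k) : R α := toR α (x 4)

theorem x₅_mem_maximalIdeal (α : k) : x₅ α ∈ IsLocalRing.maximalIdeal (R α) := by
  have h : x₅ α ^ 2 = 0 := by
    rw [x₅, ← map_pow]
    exact Ideal.Quotient.eq_zero_iff_mem.2 (Ideal.subset_span (by simp))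
  rw [IsLocalRing.mem_maximalIdeal]
  exact fun hu => not_isUnit_zero (h ▸ hu.pow 2)

instance isLocalRing_R_quotient (α : k) : IsLocalRing (R α ⧸ Ideal.span {x₅ α}) :=
  isLocalRing_quotient ((Ideal.span_singleton_le_iff_mem _).2 (x₅_mem_maximalIdeal α))

end GasharovPeeva

end

/-! The module is the cokernel of `[[x₁, x₃ + x₄], [0, x₂]]`. Its minimal resolution has every rank
equal to 2, and the differential from degree `i + 1` to degree `i` is `[[x₁, αⁱx₃ + x₄], [0, x₂]]`.
Consecutive maps compose to zero because `x₁² = x₂² = 0` and `x₁(αⁱ⁺¹x₃ + x₄) + x₂(αⁱx₃ + x₄) = 0`,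
the relations `x₂x₃ = -αx₁x₃` and `x₂x₄ = -x₁x₄` trading one power of `α`. Exactness
(`upperMatrix_exact`) needs only that the annihilators of `x₁` and `x₂` are `(x₁)` and `(x₂)`. This
also holds modulo `x₅`, so the reduced matrices resolve `M/x₅M`.

The entry ideals in positive degrees are `(x₁, x₂, αⁱx₃ + x₄)`. Comparing coefficients of `x₃` and
`x₄` shows that two of them agree, even modulo `x₅`, only if the powers of `α` agree. Degree 0 gives
the unit ideal. Nakayama's lemma makes these ideals independent of the resolution
(`MinimalFreeResolution.minors_one_eq`).

All computations take place in an explicit 12-dimensional algebra isomorphic to `R`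
(`Model.equivR`). The coefficient of `x₁x₂x₅` is a perfect trace form on it, which makes `R`
self-injective, hence Gorenstein. -/

namespace GasharovPeeva

/-! ### The explicit model: arithmetic, duality and annihilators -/

/-- The twelve-dimensional algebra with basis `1, x₁, …, x₅, x₁x₂, x₁x₃, x₁x₄, x₁x₅, x₂x₅, x₁x₂x₅`
and the multiplication prescribed by the quadrics; an element is given by its coordinates. -/
@[ext]
structure Model {k : Type*} [Field k] (α : k) where
  c0 : k
  c1 : k
  c2 : k
  c3 : k
  c4 : k
  c5 : k
  c12 : k
  c13 : k
  c14 : k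
  c15 : k
  c25 : k
  c125 : k

namespace Model

variable {k : Type*} [Field k] {α : k}

instance : Zero (Model α) := ⟨⟨0, 0, 0, 0, 0, 0, 0, 0, 0, 0, 0, 0⟩⟩
instance : One (Model α) := ⟨⟨1, 0, 0, 0, 0, 0, 0, 0, 0, 0, 0, 0⟩⟩
instance : Add (Model α) := ⟨fun a b => ⟨a.c0 + b.c0, a.c1 + b.c1, a.c2 + b.c2, a.c3 + b.c3,
  a.c4 + b.c4, a.c5 + b.c5, a.c12 + b.c12, a.c13 + b.c13, a.c14 + b.c14, a.c15 + b.c15,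
  a.c25 + b.c25, a.c125 + b.c125⟩⟩
instance : Neg (Model α) := ⟨fun a => ⟨-a.c0, -a.c1, -a.c2, -a.c3, -a.c4, -a.c5, -a.c12, -a.c13,
  -a.c14, -a.c15, -a.c25, -a.c125⟩⟩
instance : Mul (Model α) := ⟨fun a b => ⟨
  a.c0 * b.c0,
  a.c0 * b.c1 + a.c1 * b.c0,
  a.c0 * b.c2 + a.c2 * b.c0,
  a.c0 * b.c3 + a.c3 * b.c0,
  a.c0 * b.c4 + a.c4 * b.c0,
  a.c0 * b.c5 + a.c5 * b.c0,
  a.c0 * b.c12 + a.c12 * b.c0 + (a.c1 * b.c2 + a.c2 * b.c1),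
  a.c0 * b.c13 + a.c13 * b.c0 + (a.c1 * b.c3 + a.c3 * b.c1) - α * (a.c2 * b.c3 + a.c3 * b.c2),
  a.c0 * b.c14 + a.c14 * b.c0 + (a.c1 * b.c4 + a.c4 * b.c1) - (a.c2 * b.c4 + a.c4 * b.c2),
  a.c0 * b.c15 + a.c15 * b.c0 + (a.c1 * b.c5 + a.c5 * b.c1) - α * (a.c3 * b.c3) - a.c4 * b.c4,
  a.c0 * b.c25 + a.c25 * b.c0 + (a.c2 * b.c5 + a.c5 * b.c2) + a.c3 * b.c3 + a.c4 * b.c4,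
  a.c0 * b.c125 + a.c125 * b.c0 + (a.c1 * b.c25 + a.c25 * b.c1) + (a.c2 * b.c15 + a.c15 * b.c2)
    + (a.c5 * b.c12 + a.c12 * b.c5) + (a.c3 * b.c13 + a.c13 * b.c3)
    + (a.c4 * b.c14 + a.c14 * b.c4)⟩⟩

theorem zero_def : (0 : Model α) = ⟨0, 0, 0, 0, 0, 0, 0, 0, 0, 0, 0, 0⟩ := rfl
theorem one_def : (1 : Model α) = ⟨1, 0, 0, 0, 0, 0, 0, 0, 0, 0, 0, 0⟩ := rfl
theorem add_def (a b : Model α) : a + b = ⟨a.c0 + b.c0, a.c1 + b.c1, a.c2 + b.c2, a.c3 + b.c3,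
  a.c4 + b.c4, a.c5 + b.c5, a.c12 + b.c12, a.c13 + b.c13, a.c14 + b.c14, a.c15 + b.c15,
  a.c25 + b.c25, a.c125 + b.c125⟩ := rfl
theorem neg_def (a : Model α) : -a = ⟨-a.c0, -a.c1, -a.c2, -a.c3, -a.c4, -a.c5, -a.c12, -a.c13,
  -a.c14, -a.c15, -a.c25, -a.c125⟩ := rfl
theorem mul_def (a b : Model α) : a * b = ⟨
  a.c0 * b.c0,
  a.c0 * b.c1 + a.c1 * b.c0,
  a.c0 * b.c2 + a.c2 * b.c0,
  a.c0 * b.c3 + a.c3 * b.c0,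
  a.c0 * b.c4 + a.c4 * b.c0,
  a.c0 * b.c5 + a.c5 * b.c0,
  a.c0 * b.c12 + a.c12 * b.c0 + (a.c1 * b.c2 + a.c2 * b.c1),
  a.c0 * b.c13 + a.c13 * b.c0 + (a.c1 * b.c3 + a.c3 * b.c1) - α * (a.c2 * b.c3 + a.c3 * b.c2),
  a.c0 * b.c14 + a.c14 * b.c0 + (a.c1 * b.c4 + a.c4 * b.c1) - (a.c2 * b.c4 + a.c4 * b.c2),
  a.c0 * b.c15 + a.c15 * b.c0 + (a.c1 * b.c5 + a.c5 * b.c1) - α * (a.c3 * b.c3) - a.c4 * b.c4,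
  a.c0 * b.c25 + a.c25 * b.c0 + (a.c2 * b.c5 + a.c5 * b.c2) + a.c3 * b.c3 + a.c4 * b.c4,
  a.c0 * b.c125 + a.c125 * b.c0 + (a.c1 * b.c25 + a.c25 * b.c1) + (a.c2 * b.c15 + a.c15 * b.c2)
    + (a.c5 * b.c12 + a.c12 * b.c5) + (a.c3 * b.c13 + a.c13 * b.c3)
    + (a.c4 * b.c14 + a.c14 * b.c4)⟩ := rfl

instance : CommRing (Model α) where
  add_assoc a b c := by ext <;> simp only [add_def] <;> ring
  zero_add a := by ext <;> simp [add_def, zero_def]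
  add_zero a := by ext <;> simp [add_def, zero_def]
  add_comm a b := by ext <;> simp only [add_def] <;> ring
  neg_add_cancel a := by ext <;> simp [add_def, zero_def, neg_def]
  left_distrib a b c := by ext <;> simp only [add_def, mul_def] <;> ring
  right_distrib a b c := by ext <;> simp only [add_def, mul_def] <;> ring
  zero_mul a := by ext <;> simp [mul_def, zero_def]
  mul_zero a := by ext <;> simp [mul_def, zero_def]
  mul_assoc a b c := by ext <;> simp only [mul_def] <;> ring
  one_mul a := by ext <;> simp [mul_def, one_def]
  mul_one a := by ext <;> simp [mul_def, one_def]
  mul_comm a b := by ext <;> simp only [mul_def] <;> ring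
  nsmul := nsmulRec
  zsmul := zsmulRec

instance : Algebra k (Model α) :=
  RingHom.toAlgebra
    { toFun := fun c => ⟨c, 0, 0, 0, 0, 0, 0, 0, 0, 0, 0, 0⟩
      map_one' := rfl
      map_mul' := fun a b => by ext <;> simp [mul_def]
      map_zero' := rfl
      map_add' := fun a b => by ext <;> simp [add_def] }

theorem algebraMap_def (c : k) :
    algebraMap k (Model α) c = ⟨c, 0, 0, 0, 0, 0, 0, 0, 0, 0, 0, 0⟩ := rfl

theorem smul_def (c : k) (a : Model α) : c • a = ⟨c * a.c0, c * a.c1, c * a.c2, c * a.c3, c * a.c4,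
    c * a.c5, c * a.c12, c * a.c13, c * a.c14, c * a.c15, c * a.c25, c * a.c125⟩ := by
  rw [Algebra.smul_def, algebraMap_def]
  ext <;> simp [mul_def]

/-- The images of the five variables. -/
def gen : Fin 5 → Model α :=
  ![⟨0, 1, 0, 0, 0, 0, 0, 0, 0, 0, 0, 0⟩, ⟨0, 0, 1, 0, 0, 0, 0, 0, 0, 0, 0, 0⟩,
    ⟨0, 0, 0, 1, 0, 0, 0, 0, 0, 0, 0, 0⟩, ⟨0, 0, 0, 0, 1, 0, 0, 0, 0, 0, 0, 0⟩,
    ⟨0, 0, 0, 0, 0, 1, 0, 0, 0, 0, 0, 0⟩]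

theorem gen0 : (gen 0 : Model α) = ⟨0, 1, 0, 0, 0, 0, 0, 0, 0, 0, 0, 0⟩ := rfl
theorem gen1 : (gen 1 : Model α) = ⟨0, 0, 1, 0, 0, 0, 0, 0, 0, 0, 0, 0⟩ := rfl
theorem gen2 : (gen 2 : Model α) = ⟨0, 0, 0, 1, 0, 0, 0, 0, 0, 0, 0, 0⟩ := rfl
theorem gen3 : (gen 3 : Model α) = ⟨0, 0, 0, 0, 1, 0, 0, 0, 0, 0, 0, 0⟩ := rfl
theorem gen4 : (gen 4 : Model α) = ⟨0, 0, 0, 0, 0, 1, 0, 0, 0, 0, 0, 0⟩ := rfl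

instance : Module.Finite k (Model α) := by
  let f : (Fin 12 → k) →ₗ[k] Model α :=
    { toFun := fun v => ⟨v 0, v 1, v 2, v 3, v 4, v 5, v 6, v 7, v 8, v 9, v 10, v 11⟩
      map_add' := fun _ _ => rfl
      map_smul' := fun c v => by simp [smul_def] }
  exact Module.Finite.of_surjective f fun a =>
    ⟨![a.c0, a.c1, a.c2, a.c3, a.c4, a.c5, a.c12, a.c13, a.c14, a.c15, a.c25, a.c125], rfl⟩

/-- The constant coefficient. -/
def augmentation : Model α →+* k where
  toFun := c0
  map_one' := rfl
  map_mul' _ _ := rfl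
  map_zero' := rfl
  map_add' _ _ := rfl

/-- The socle coefficient. -/
def trace : Model α →ₗ[k] k where
  toFun := c125
  map_add' _ _ := rfl
  map_smul' c a := by simp [smul_def]

theorem isNilpotent_of_c0_eq_zero {a : Model α} (h : a.c0 = 0) : IsNilpotent a := by
  refine ⟨4, ?_⟩
  -- The multiplication is graded with top degree 3, so fourth powers of elements without constant
  -- term vanish.
  rw [show (4 : ℕ) = 2 + 2 from rfl, pow_add, sq]
  ext <;> simp only [mul_def, zero_def, h] <;> ring

theorem isUnit_of_c0_ne_zero {a : Model α} (h : a.c0 ≠ 0) : IsUnit a := by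
  have hn : IsNilpotent (a - algebraMap k (Model α) a.c0) := by
    refine isNilpotent_of_c0_eq_zero ?_
    simp [sub_eq_add_neg, algebraMap_def, add_def, neg_def]
  have hu : IsUnit (algebraMap k (Model α) a.c0) := (isUnit_iff_ne_zero.2 h).map _
  simpa using hn.isUnit_add_left_of_commute hu (Commute.all _ _)

/-- Under the trace pairing the monomial basis is its own dual up to order: `1 ↔ x₁x₂x₅`, `x₁ ↔
x₂x₅`, `x₂ ↔ x₁x₅`, `x₃ ↔ x₁x₃`, `x₄ ↔ x₁x₄`, `x₅ ↔ x₁x₂`. Each coordinate of the witness is `ψ` at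
the dual monomial. -/
theorem exists_trace_mul_eq (ψ : Model α →ₗ[k] k) : ∃ s, ∀ r, trace (r * s) = ψ r := by
  refine ⟨⟨ψ ⟨0, 0, 0, 0, 0, 0, 0, 0, 0, 0, 0, 1⟩, ψ ⟨0, 0, 0, 0, 0, 0, 0, 0, 0, 0, 1, 0⟩,
    ψ ⟨0, 0, 0, 0, 0, 0, 0, 0, 0, 1, 0, 0⟩, ψ ⟨0, 0, 0, 0, 0, 0, 0, 1, 0, 0, 0, 0⟩,
    ψ ⟨0, 0, 0, 0, 0, 0, 0, 0, 1, 0, 0, 0⟩, ψ ⟨0, 0, 0, 0, 0, 0, 1, 0, 0, 0, 0, 0⟩,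
    ψ ⟨0, 0, 0, 0, 0, 1, 0, 0, 0, 0, 0, 0⟩, ψ ⟨0, 0, 0, 1, 0, 0, 0, 0, 0, 0, 0, 0⟩,
    ψ ⟨0, 0, 0, 0, 1, 0, 0, 0, 0, 0, 0, 0⟩, ψ ⟨0, 0, 1, 0, 0, 0, 0, 0, 0, 0, 0, 0⟩,
    ψ ⟨0, 1, 0, 0, 0, 0, 0, 0, 0, 0, 0, 0⟩, ψ ⟨1, 0, 0, 0, 0, 0, 0, 0, 0, 0, 0, 0⟩⟩, fun r => ?_⟩
  have hr : r = r.c0 • ⟨1, 0, 0, 0, 0, 0, 0, 0, 0, 0, 0, 0⟩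
      + r.c1 • ⟨0, 1, 0, 0, 0, 0, 0, 0, 0, 0, 0, 0⟩ + r.c2 • ⟨0, 0, 1, 0, 0, 0, 0, 0, 0, 0, 0, 0⟩
      + r.c3 • ⟨0, 0, 0, 1, 0, 0, 0, 0, 0, 0, 0, 0⟩ + r.c4 • ⟨0, 0, 0, 0, 1, 0, 0, 0, 0, 0, 0, 0⟩
      + r.c5 • ⟨0, 0, 0, 0, 0, 1, 0, 0, 0, 0, 0, 0⟩ + r.c12 • ⟨0, 0, 0, 0, 0, 0, 1, 0, 0, 0, 0, 0⟩
      + r.c13 • ⟨0, 0, 0, 0, 0, 0, 0, 1, 0, 0, 0, 0⟩ + r.c14 • ⟨0, 0, 0, 0, 0, 0, 0, 0, 1, 0, 0, 0⟩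
      + r.c15 • ⟨0, 0, 0, 0, 0, 0, 0, 0, 0, 1, 0, 0⟩ + r.c25 • ⟨0, 0, 0, 0, 0, 0, 0, 0, 0, 0, 1, 0⟩
      + r.c125 • ⟨0, 0, 0, 0, 0, 0, 0, 0, 0, 0, 0, 1⟩ := by
    ext <;> simp [smul_def, add_def]
  conv_rhs => rw [hr]
  simp only [map_add, map_smul, smul_eq_mul]
  change Model.c125 (_ * _) = _
  simp only [mul_def]
  ring

theorem eq_zero_of_trace_mul {s : Model α} (h : ∀ r, trace (r * s) = 0) : s = 0 := by
  have h' : ∀ r : Model α, (r * s).c125 = 0 := h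
  rw [zero_def]
  ext
  · simpa [mul_def] using h' ⟨0, 0, 0, 0, 0, 0, 0, 0, 0, 0, 0, 1⟩
  · simpa [mul_def] using h' ⟨0, 0, 0, 0, 0, 0, 0, 0, 0, 0, 1, 0⟩
  · simpa [mul_def] using h' ⟨0, 0, 0, 0, 0, 0, 0, 0, 0, 1, 0, 0⟩
  · simpa [mul_def] using h' ⟨0, 0, 0, 0, 0, 0, 0, 1, 0, 0, 0, 0⟩
  · simpa [mul_def] using h' ⟨0, 0, 0, 0, 0, 0, 0, 0, 1, 0, 0, 0⟩
  · simpa [mul_def] using h' ⟨0, 0, 0, 0, 0, 0, 1, 0, 0, 0, 0, 0⟩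
  · simpa [mul_def] using h' ⟨0, 0, 0, 0, 0, 1, 0, 0, 0, 0, 0, 0⟩
  · simpa [mul_def] using h' ⟨0, 0, 0, 1, 0, 0, 0, 0, 0, 0, 0, 0⟩
  · simpa [mul_def] using h' ⟨0, 0, 0, 0, 1, 0, 0, 0, 0, 0, 0, 0⟩
  · simpa [mul_def] using h' ⟨0, 0, 1, 0, 0, 0, 0, 0, 0, 0, 0, 0⟩
  · simpa [mul_def] using h' ⟨0, 1, 0, 0, 0, 0, 0, 0, 0, 0, 0, 0⟩
  · simpa [mul_def] using h' ⟨1, 0, 0, 0, 0, 0, 0, 0, 0, 0, 0, 0⟩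

/-- The annihilator of `x₁` is generated by `x₁`. -/
theorem exists_of_gen0_mul {r : Model α} (h : gen 0 * r = 0) : ∃ s, r = gen 0 * s := by
  simp only [gen0, mul_def, zero_def, Model.mk.injEq] at h
  -- The hypothesis kills every coordinate of `r` at a monomial not divisible by `x₁`; the witness
  -- is `r` with `x₁` divided out.
  refine ⟨⟨r.c1, 0, r.c12, r.c13, r.c14, r.c15, 0, 0, 0, 0, r.c125, 0⟩, ?_⟩
  ext <;> simp [gen0, mul_def] <;> grind

/-- The annihilator of `x₁` modulo `x₅` is generated by `x₁`. -/
theorem exists_of_gen0_mul_eq {r u : Model α} (h : gen 0 * r = gen 4 * u) :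
    ∃ s t, r = gen 0 * s + gen 4 * t := by
  simp only [gen0, gen4, mul_def, Model.mk.injEq] at h
  -- Monomials divisible by `x₅` go into the second factor, the others are divided by `x₁`.
  refine ⟨⟨r.c1, 0, r.c12, r.c13, r.c14, 0, 0, 0, 0, 0, 0, 0⟩,
    ⟨r.c5, r.c15, r.c25, 0, 0, 0, r.c125, 0, 0, 0, 0, 0⟩, ?_⟩
  ext <;> simp [gen0, gen4, mul_def, add_def] <;> grind

/-- The annihilator of `x₂` is generated by `x₂`. -/
theorem exists_of_gen1_mul (hα : α ≠ 0) {r : Model α} (h : gen 1 * r = 0) : ∃ s, r = gen 1 * s := by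
  simp only [gen1, mul_def, zero_def, Model.mk.injEq] at h
  -- Here `x₁x₃ = -α⁻¹x₂x₃` and `x₁x₄ = -x₂x₄` are also multiples of `x₂`.
  refine ⟨⟨r.c2, r.c12, 0, -α⁻¹ * r.c13, -r.c14, r.c25, 0, 0, 0, r.c125, 0, 0⟩, ?_⟩
  ext <;> simp [gen1, mul_def] <;> grind

/-- The annihilator of `x₂` modulo `x₅` is generated by `x₂`. -/
theorem exists_of_gen1_mul_eq (hα : α ≠ 0) {r u : Model α} (h : gen 1 * r = gen 4 * u) :
    ∃ s t, r = gen 1 * s + gen 4 * t := by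
  simp only [gen1, gen4, mul_def, Model.mk.injEq] at h
  refine ⟨⟨r.c2, r.c12, 0, -α⁻¹ * r.c13, -r.c14, 0, 0, 0, 0, 0, 0, 0⟩,
    ⟨r.c5, r.c15, r.c25, 0, 0, 0, r.c125, 0, 0, 0, 0, 0⟩, ?_⟩
  ext <;> simp [gen1, gen4, mul_def, add_def] <;> grind

/-- Only `r`'s constant term `r₀` reaches the coefficients of `x₃` and `x₄`, which read `c = r₀d`
and `1 = r₀`. -/
theorem eq_of_eq_combination {c d : k} {r p q s : Model α}
    (h : algebraMap k _ c * gen 2 + gen 3 -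
      (r * (algebraMap k _ d * gen 2 + gen 3) + (p * gen 0 + q * gen 1)) = gen 4 * s) : c = d := by
  rw [sub_eq_iff_eq_add] at h
  simp only [algebraMap_def, gen0, gen1, gen2, gen3, gen4, mul_def, add_def, Model.mk.injEq] at h
  grind

theorem gen_zero_mul_self : (gen 0 * gen 0 : Model α) = 0 := by
  rw [zero_def]
  ext <;> simp [gen0, mul_def]

theorem gen_one_mul_self : (gen 1 * gen 1 : Model α) = 0 := by
  rw [zero_def]
  ext <;> simp [gen1, mul_def]

theorem gen_mul_add_gen_mul (c : k) :
    gen 0 * (algebraMap k (Model α) (c * α) * gen 2 + gen 3) +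
      gen 1 * (algebraMap k (Model α) c * gen 2 + gen 3) = 0 := by
  simp only [algebraMap_def, gen0, gen1, gen2, gen3, mul_def, add_def]
  rw [zero_def]
  ext <;> simp
  ring

end Model
end GasharovPeeva

/-! ### The isomorphism of the model with `R` -/

namespace GasharovPeeva

open MvPolynomial (idealOfVars)

variable {k : Type*} [Field k] {α : k}

namespace Model

/-- The evaluation of polynomials in the model. -/
noncomputable abbrev eval (α : k) : MvPolynomial (Fin 5) k →ₐ[k] Model α :=
  MvPolynomial.aeval gen

/-- The polynomial in the monomial basis with given coordinates. -/
noncomputable def poly (a : Model α) : MvPolynomial (Fin 5) k :=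
  open MvPolynomial in
  C a.c0 + C a.c1 * X 0 + C a.c2 * X 1 + C a.c3 * X 2 + C a.c4 * X 3 + C a.c5 * X 4
    + C a.c12 * (X 0 * X 1) + C a.c13 * (X 0 * X 2) + C a.c14 * (X 0 * X 3) + C a.c15 * (X 0 * X 4)
    + C a.c25 * (X 1 * X 4) + C a.c125 * (X 0 * X 1 * X 4)

theorem eval_poly (a : Model α) : eval α (poly a) = a := by
  have h01 : (gen 0 * gen 1 : Model α) = ⟨0, 0, 0, 0, 0, 0, 1, 0, 0, 0, 0, 0⟩ := by
    ext <;> simp [gen0, gen1, mul_def]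
  have h02 : (gen 0 * gen 2 : Model α) = ⟨0, 0, 0, 0, 0, 0, 0, 1, 0, 0, 0, 0⟩ := by
    ext <;> simp [gen0, gen2, mul_def]
  have h03 : (gen 0 * gen 3 : Model α) = ⟨0, 0, 0, 0, 0, 0, 0, 0, 1, 0, 0, 0⟩ := by
    ext <;> simp [gen0, gen3, mul_def]
  have h04 : (gen 0 * gen 4 : Model α) = ⟨0, 0, 0, 0, 0, 0, 0, 0, 0, 1, 0, 0⟩ := by
    ext <;> simp [gen0, gen4, mul_def]
  have h14 : (gen 1 * gen 4 : Model α) = ⟨0, 0, 0, 0, 0, 0, 0, 0, 0, 0, 1, 0⟩ := by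
    ext <;> simp [gen1, gen4, mul_def]
  have h124 : (⟨0, 0, 0, 0, 0, 0, 1, 0, 0, 0, 0, 0⟩ * gen 4 : Model α) =
      ⟨0, 0, 0, 0, 0, 0, 0, 0, 0, 0, 0, 1⟩ := by
    ext <;> simp [gen4, mul_def]
  simp only [poly, map_add, map_mul, eval, MvPolynomial.aeval_C, MvPolynomial.aeval_X, h124, h01,
    h02, h03, h04, h14]
  simp only [gen0, gen1, gen2, gen3, gen4, ← Algebra.smul_def, smul_def, mul_zero, mul_one]
  simp only [algebraMap_def, add_def, add_zero, zero_add]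

theorem eval_c0 (p : MvPolynomial (Fin 5) k) :
    (eval α p).c0 = MvPolynomial.constantCoeff p := by
  have h : (augmentation.comp (eval α : MvPolynomial (Fin 5) k →+* Model α)) =
      MvPolynomial.constantCoeff := by
    refine MvPolynomial.ringHom_ext (fun c => ?_) fun i => ?_
    · simp [augmentation, algebraMap_def]
    · fin_cases i <;> simp [augmentation, gen]
  exact congrArg (fun f => f p) h

theorem isUnit_eval (y : (idealOfVars (Fin 5) k).primeCompl) :
    IsUnit ((eval α : MvPolynomial (Fin 5) k →+* Model α) y) := by
  refine isUnit_of_c0_ne_zero ?_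
  have hy : (y : MvPolynomial (Fin 5) k) ∉ idealOfVars (Fin 5) k := y.2
  rw [mem_idealOfVars_iff] at hy
  exact (eval_c0 (α := α) y.1).symm ▸ hy

/-- The evaluation at the model of the elements of the regular local ring. -/
noncomputable def evalS (α : k) : S k →+* Model α :=
  IsLocalization.lift (M := (idealOfVars (Fin 5) k).primeCompl) isUnit_eval

theorem evalS_algebraMap (p : MvPolynomial (Fin 5) k) :
    evalS α (algebraMap _ (S k) p) = eval α p :=
  IsLocalization.lift_eq _ _

theorem evalS_x (j : Fin 5) : evalS α (x j) = gen j := by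
  rw [x, evalS_algebraMap, eval, MvPolynomial.aeval_X]

theorem evalS_algebraMap' (c : k) : evalS α (algebraMap k (S k) c) = algebraMap k _ c := by
  rw [IsScalarTower.algebraMap_apply k (MvPolynomial (Fin 5) k) (S k), evalS_algebraMap,
    AlgHom.commutes]

theorem quadricIdeal_le_ker : quadricIdeal α ≤ RingHom.ker (evalS α) := by
  refine Ideal.span_le.2 ?_
  rintro a (rfl | rfl | rfl | rfl | rfl | rfl | rfl | rfl | rfl | rfl) <;>
  simp only [SetLike.mem_coe, RingHom.mem_ker, map_add, map_mul, map_neg, evalS_x,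
    evalS_algebraMap', sq, sub_eq_add_neg, neg_def, gen0, gen1, gen2, gen3, gen4, mul_def, add_def,
    algebraMap_def] <;>
  rw [zero_def] <;> ext <;> simp

/-- The map from the Gasharov–Peeva ring to the model. -/
noncomputable def ofR (α : k) : R α →+* Model α :=
  Ideal.Quotient.lift (quadricIdeal α) (evalS α) fun _ h => quadricIdeal_le_ker h

/-- The map from the polynomial ring to the Gasharov–Peeva ring. -/
noncomputable def polyToR (α : k) : MvPolynomial (Fin 5) k →+* R α :=
  (toR α).comp (algebraMap _ (S k))

theorem ofR_polyToR (p : MvPolynomial (Fin 5) k) : ofR α (polyToR α p) = eval α p :=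
  evalS_algebraMap p

theorem toR_eq_zero {s : S k} (h : s ∈ quadricIdeal α) : toR α s = 0 :=
  Ideal.Quotient.eq_zero_iff_mem.2 h

theorem polyToR_poly_add (a b : Model α) :
    polyToR α (poly (a + b)) = polyToR α (poly a) + polyToR α (poly b) := by
  have h : poly (a + b) = poly a + poly b := by
    simp only [poly, add_def, MvPolynomial.C_add, add_mul]
    abel
  rw [h, map_add]

theorem polyToR_poly_algebraMap (c : k) :
    polyToR α (poly (algebraMap k (Model α) c)) = polyToR α (MvPolynomial.C c) := by
  have h : poly (algebraMap k (Model α) c) = MvPolynomial.C c := by simp [poly, algebraMap_def]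
  rw [h]

/-- The spanning half of the isomorphism: modulo the quadrics, a basis monomial times a variable
reduces to the twelve monomials exactly as the multiplication table says. -/
theorem polyToR_poly_mul_gen (a : Model α) (j : Fin 5) :
    polyToR α (poly (a * gen j)) = polyToR α (poly a) * polyToR α (MvPolynomial.X j) := by
  let y (j : Fin 5) : R α := polyToR α (MvPolynomial.X j)
  let c (b : k) : R α := polyToR α (MvPolynomial.C b)
  have hx (j : Fin 5) : toR α (x j) = y j := rfl
  have hc (b : k) : toR α (algebraMap k (S k) b) = c b := by
    rw [IsScalarTower.algebraMap_apply k (MvPolynomial (Fin 5) k) (S k)]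
    rfl
  have hmem {s : S k} (h : s ∈ _) : toR α s = 0 := toR_eq_zero (Ideal.subset_span h)
  have h1 := hmem (s := x 0 ^ 2) (by simp)
  have h2 := hmem (s := x 1 ^ 2) (by simp)
  have h3 := hmem (s := x 2 * x 3) (by simp)
  have h4 := hmem (s := x 2 * x 4) (by simp)
  have h5 := hmem (s := x 3 * x 4) (by simp)
  have h6 := hmem (s := x 4 ^ 2) (by simp)
  have h7 := hmem (s := algebraMap k (S k) α * x 0 * x 2 + x 1 * x 2) (by simp)
  have h8 := hmem (s := x 0 * x 3 + x 1 * x 3) (by simp)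
  have h9 := hmem (s := x 2 ^ 2 - x 1 * x 4 + algebraMap k (S k) α * x 0 * x 4) (by simp)
  have h10 := hmem (s := x 3 ^ 2 - x 1 * x 4 + x 0 * x 4) (by simp)
  simp only [map_add, map_sub, map_mul, map_pow, hx, hc] at h1 h2 h3 h4 h5 h6 h7 h8 h9 h10
  change _ = _ * y j
  have hcd (b : k) : polyToR α (MvPolynomial.C b) = c b := rfl
  have hyd (j : Fin 5) : polyToR α (MvPolynomial.X j) = y j := rfl
  fin_cases j <;>
  simp only [Fin.zero_eta, Fin.mk_one, Fin.reduceFinMk, poly, gen0, gen1, gen2, gen3, gen4, mul_def,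
    map_add, map_sub, map_mul, hyd, hcd, map_zero, map_one]
  · linear_combination -h1 * (c a.c1 + c a.c12 * y 1 + c a.c13 * y 2 + c a.c14 * y 3 + c a.c15 * y 4
      + c a.c125 * y 1 * y 4)
  -- The combinations `h7 * y 0 - c α * y 2 * h1` and `h8 * y 0 - y 3 * h1` are the cubic relations
  -- `x₁x₂x₃ = 0` and `x₁x₂x₄ = 0`.
  · linear_combination -h2 * (c a.c2 + c a.c12 * y 0 + c a.c25 * y 4 + c a.c125 * y 0 * y 4)
      - h7 * c a.c3 - h8 * c a.c4 - c a.c13 * (h7 * y 0 - c α * y 2 * h1)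
      - c a.c14 * (h8 * y 0 - y 3 * h1)
  · linear_combination -h7 * c a.c2 - h9 * c a.c3 - h3 * c a.c4 - h4 * c a.c5
      - c a.c12 * (h7 * y 0 - c α * y 2 * h1) - c a.c13 * (h9 * y 0 - c α * y 4 * h1)
      - c a.c14 * y 0 * h3 - (c a.c15 * y 0 + c a.c25 * y 1 + c a.c125 * y 0 * y 1) * h4
  · linear_combination -h8 * c a.c2 - h3 * c a.c3 - h10 * c a.c4 - h5 * c a.c5
      - c a.c12 * (h8 * y 0 - y 3 * h1) - c a.c14 * (h10 * y 0 - y 4 * h1)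
      - c a.c13 * y 0 * h3 - (c a.c15 * y 0 + c a.c25 * y 1 + c a.c125 * y 0 * y 1) * h5
  · linear_combination -h4 * c a.c3 - h5 * c a.c4 - h6 * c a.c5 - c a.c13 * y 0 * h4
      - c a.c14 * y 0 * h5 - (c a.c15 * y 0 + c a.c25 * y 1 + c a.c125 * y 0 * y 1) * h6

/-- Although `poly` is not multiplicative, this makes `polyToR α ∘ poly` so, since products can be
formed among polynomials and then reduced. -/
theorem polyToR_poly_eval (p : MvPolynomial (Fin 5) k) :
    polyToR α (poly (eval α p)) = polyToR α p := by
  induction p using MvPolynomial.induction_on with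
  | C c => rw [eval, MvPolynomial.aeval_C, polyToR_poly_algebraMap]
  | add p q hp hq => rw [map_add, polyToR_poly_add, hp, hq, map_add]
  | mul_X p j hp => rw [map_mul, eval, MvPolynomial.aeval_X, polyToR_poly_mul_gen, hp, map_mul]

/-- The model is isomorphic to the Gasharov–Peeva ring. -/
noncomputable def equivR (α : k) : Model α ≃+* R α :=
  RingEquiv.ofRingHom
    { toFun := fun a => polyToR α (poly a)
      map_one' := by simpa using polyToR_poly_eval (α := α) 1
      map_mul' := fun a b => by
        simpa [eval_poly] using polyToR_poly_eval (α := α) (poly a * poly b)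
      map_zero' := by simpa using polyToR_poly_eval (α := α) 0
      map_add' := polyToR_poly_add }
    (ofR α)
    (by
      refine Ideal.Quotient.ringHom_ext
        (IsLocalization.ringHom_ext (idealOfVars (Fin 5) k).primeCompl (RingHom.ext fun p => ?_))
      change polyToR α (poly (ofR α (polyToR α p))) = polyToR α p
      rw [ofR_polyToR, polyToR_poly_eval])
    (RingHom.ext fun a => (ofR_polyToR _).trans (eval_poly a))

theorem equivR_symm_toR (s : S k) : (equivR α).symm (toR α s) = evalS α s := rfl

theorem equivR_gen (j : Fin 5) : equivR α (gen j) = toR α (x j) := by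
  apply (equivR α).symm.injective
  rw [RingEquiv.symm_apply_apply, equivR_symm_toR, evalS_x]

end Model
end GasharovPeeva

/-! ### Uniqueness of minimal resolutions and invariance of the entry ideals -/

section MinimalResolutions

variable {A : Type*} [CommRing A]

/-- The ideal generated by the coordinates of the elements of a submodule of a free module. -/
def coordIdeal {n : ℕ} (N : Submodule A (Fin n → A)) : Ideal A :=
  Ideal.span {a | ∃ v ∈ N, ∃ j, a = v j}

theorem coordIdeal_map_le {m n : ℕ} (e : (Fin m → A) →ₗ[A] (Fin n → A))
    (N : Submodule A (Fin m → A)) : coordIdeal (N.map e) ≤ coordIdeal N := by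
  refine Ideal.span_le.2 ?_
  rintro _ ⟨_, ⟨v, hv, rfl⟩, j, rfl⟩
  rw [← LinearMap.toMatrix'_mulVec e v]
  simp only [Matrix.mulVec, dotProduct]
  exact Ideal.sum_mem _ fun i _ => Ideal.mul_mem_left _ _ (Ideal.subset_span ⟨v, hv, i, rfl⟩)

theorem coordIdeal_map_equiv {m n : ℕ} (e : (Fin m → A) ≃ₗ[A] (Fin n → A))
    (N : Submodule A (Fin m → A)) : coordIdeal (N.map (e : (Fin m → A) →ₗ[A] (Fin n → A))) =
      coordIdeal N := by
  refine le_antisymm (coordIdeal_map_le _ _) ?_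
  convert coordIdeal_map_le (e.symm : (Fin n → A) →ₗ[A] (Fin m → A)) (N.map (e : _ →ₗ[A] _))
  rw [← Submodule.map_comp]
  simp

/-- Expresses the entry ideal through the image of the matrix alone, so that only the syzygy inside
its free module matters. Nonzero sizes exclude the unit-ideal convention. -/
theorem minorsIdeal_one {m n : ℕ} (hm : m ≠ 0) (hn : n ≠ 0) (D : Matrix (Fin m) (Fin n) A) :
    minorsIdeal 1 D = coordIdeal (LinearMap.range D.mulVecLin) := by
  rw [minorsIdeal, if_neg (by tauto), coordIdeal]
  refine le_antisymm (Ideal.span_le.2 ?_) (Ideal.span_le.2 ?_)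
  · rintro _ ⟨f, g, rfl⟩
    refine Ideal.subset_span ⟨D.mulVecLin (Pi.single (g 0) 1), ⟨_, rfl⟩, f 0, ?_⟩
    simp
  · rintro _ ⟨_, ⟨w, rfl⟩, i, rfl⟩
    simp only [Matrix.mulVecLin_apply, Matrix.mulVec, dotProduct]
    refine Ideal.sum_mem _ fun j _ => Ideal.mul_mem_right _ _ (Ideal.subset_span ?_)
    exact ⟨⟨fun _ => i, Function.injective_of_subsingleton _⟩,
      ⟨fun _ => j, Function.injective_of_subsingleton _⟩, by simp⟩

variable [IsLocalRing A]

/-- Nakayama's lemma: the map is the identity modulo the maximal ideal. -/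
theorem surjective_of_sub_mem_maximalIdeal {n : ℕ} (h : (Fin n → A) →ₗ[A] (Fin n → A))
    (hh : ∀ v j, (h v - v) j ∈ IsLocalRing.maximalIdeal A) : Function.Surjective h := by
  rw [← LinearMap.range_eq_top]
  refine top_le_iff.1 (Submodule.le_of_le_smul_of_le_jacobson_bot
    (I := IsLocalRing.maximalIdeal A) Module.Finite.fg_top
    (IsLocalRing.maximalIdeal_le_jacobson _) fun v _ => ?_)
  have h1 : v = h v + -(h v - v) := by abel
  rw [h1]
  refine Submodule.add_mem_sup ⟨v, rfl⟩ (neg_mem ?_)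
  rw [pi_eq_sum_univ' (h v - v)]
  exact Submodule.sum_mem _ fun j _ => Submodule.smul_mem_smul (hh v j) trivial

/-- Two minimal covers of the same submodule by free modules are isomorphic. -/
theorem exists_equiv_of_range_eq {m n : ℕ} {N : Type*} [AddCommGroup N] [Module A N]
    (f : (Fin m → A) →ₗ[A] N) (g : (Fin n → A) →ₗ[A] N)
    (hfg : LinearMap.range f = LinearMap.range g)
    (hf : ∀ v, f v = 0 → ∀ j, v j ∈ IsLocalRing.maximalIdeal A)
    (hg : ∀ v, g v = 0 → ∀ j, v j ∈ IsLocalRing.maximalIdeal A) :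
    ∃ e : (Fin m → A) ≃ₗ[A] (Fin n → A), ∀ v, g (e v) = f v := by
  obtain ⟨h, hh⟩ := Module.projective_lifting_property g.rangeRestrict
    (f.codRestrict (LinearMap.range g) fun v => hfg ▸ ⟨v, rfl⟩) g.surjective_rangeRestrict
  obtain ⟨h', hh'⟩ := Module.projective_lifting_property f.rangeRestrict
    (g.codRestrict (LinearMap.range f) fun v => hfg ▸ ⟨v, rfl⟩) f.surjective_rangeRestrict
  have hgh (v) : g (h v) = f v := congrArg Subtype.val (congrArg (fun l => l v) hh)
  have hfh (v) : f (h' v) = g v := congrArg Subtype.val (congrArg (fun l => l v) hh')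
  -- Since `f ∘ h' ∘ h = f`, the difference from the identity lies in the kernel of `f`, whose
  -- coordinates are in the maximal ideal.
  have s1 : Function.Surjective (h' ∘ₗ h) := surjective_of_sub_mem_maximalIdeal _ fun v =>
    hf _ (by simp [hgh, hfh])
  have s2 : Function.Surjective (h ∘ₗ h') := surjective_of_sub_mem_maximalIdeal _ fun v =>
    hg _ (by simp [hgh, hfh])
  have i1 := OrzechProperty.injective_of_surjective_endomorphism _ s1
  refine ⟨LinearEquiv.ofBijective h ⟨Function.Injective.of_comp (f := h') i1,
    Function.Surjective.of_comp (g := h') s2⟩, hgh⟩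

namespace MinimalFreeResolution

variable {M : Type*} [AddCommGroup M] [Module A M]

theorem mem_maximalIdeal_of_mem_range (F : MinimalFreeResolution A M) (i : ℕ)
    {v : Fin (F.rank i) → A} (hv : v ∈ LinearMap.range (F.mat i).mulVecLin) (j) :
    v j ∈ IsLocalRing.maximalIdeal A := by
  obtain ⟨w, rfl⟩ := hv
  simp only [Matrix.mulVecLin_apply, Matrix.mulVec, dotProduct]
  exact Ideal.sum_mem _ fun l _ => Ideal.mul_mem_right _ _ (F.minimal i j l)

/-- Any two minimal free resolutions have isomorphic syzygies, compatibly with the free modules. -/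
theorem exists_equiv (F G : MinimalFreeResolution A M) (i : ℕ) :
    ∃ e : (Fin (F.rank i) → A) ≃ₗ[A] (Fin (G.rank i) → A),
      (LinearMap.range (F.mat i).mulVecLin).map (e : _ →ₗ[A] _) =
        LinearMap.range (G.mat i).mulVecLin := by
  induction i with
  | zero =>
    obtain ⟨e, he⟩ := exists_equiv_of_range_eq F.augmentation G.augmentation
      (by rw [LinearMap.range_eq_top.2 F.augmentation_surjective,
        LinearMap.range_eq_top.2 G.augmentation_surjective])
      (fun v hv => F.mem_maximalIdeal_of_mem_range 0 ((F.exact_zero v).1 hv))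
      (fun v hv => G.mem_maximalIdeal_of_mem_range 0 ((G.exact_zero v).1 hv))
    refine ⟨e, ?_⟩
    ext v
    obtain ⟨w, rfl⟩ := e.surjective v
    rw [← F.exact_zero.linearMap_ker_eq, ← G.exact_zero.linearMap_ker_eq,
      LinearMap.mem_ker, he]
    simp
  | succ i ih =>
    obtain ⟨e₀, he₀⟩ := ih
    -- Transporting by `e₀` makes both differentials minimal covers of one submodule of `G`'s free
    -- module in degree `i`.
    obtain ⟨e, he⟩ := exists_equiv_of_range_eq
      ((e₀ : (Fin (F.rank i) → A) →ₗ[A] (Fin (G.rank i) → A)) ∘ₗ (F.mat i).mulVecLin)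
      (G.mat i).mulVecLin
      (by rw [LinearMap.range_comp, he₀])
      (fun v hv => F.mem_maximalIdeal_of_mem_range (i + 1)
        ((F.exact_succ i v).1 (e₀.map_eq_zero_iff.1 hv)))
      (fun v hv => G.mem_maximalIdeal_of_mem_range (i + 1) ((G.exact_succ i v).1 hv))
    refine ⟨e, ?_⟩
    ext v
    obtain ⟨w, rfl⟩ := e.surjective v
    rw [← (F.exact_succ i).linearMap_ker_eq, ← (G.exact_succ i).linearMap_ker_eq,
      LinearMap.mem_ker, he]
    simp

theorem rank_eq (F G : MinimalFreeResolution A M) (i : ℕ) : F.rank i = G.rank i := by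
  obtain ⟨e, -⟩ := F.exists_equiv G i
  simpa using e.finrank_eq

/-- The ideals of entries do not depend on the minimal free resolution. -/
theorem minors_one_eq (F G : MinimalFreeResolution A M) (i : ℕ) :
    F.minors 1 i = G.minors 1 i := by
  cases i with
  | zero => simp [minors, minorsIdeal]
  | succ i =>
    by_cases h : F.rank i = 0 ∨ F.rank (i + 1) = 0
    · have h' := h
      rw [F.rank_eq G, F.rank_eq G] at h'
      rw [minors, minors, minorsIdeal, minorsIdeal, if_pos h, if_pos h']
    · have h' := h
      rw [F.rank_eq G, F.rank_eq G] at h'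
      rw [not_or] at h h'
      obtain ⟨e, he⟩ := F.exists_equiv G i
      rw [minors, minors, minorsIdeal_one h.1 h.2, minorsIdeal_one h'.1 h'.2, ← he,
        coordIdeal_map_equiv]

end MinimalFreeResolution

end MinimalResolutions

/-! ### Self-injectivity from a perfect trace form -/

section SelfInjective

/-- An algebra over a field with a perfect trace form is injective over itself. -/
theorem Module.Baer.of_trace {k B : Type*} [Field k] [CommRing B] [Algebra k B] (t : B →ₗ[k] k)
    (hex : ∀ ψ : B →ₗ[k] k, ∃ s, ∀ r, t (r * s) = ψ r)
    (hzero : ∀ s, (∀ r, t (r * s) = 0) → s = 0) : Module.Baer B B := by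
  intro I g
  -- Extend `t ∘ g` from `I` to a functional on `B` and represent it by `s`; nondegeneracy then
  -- forces `g` to be multiplication by `s`.
  obtain ⟨ψ, hψ⟩ := (t ∘ₗ g.restrictScalars k).exists_extend (p := I.restrictScalars k)
  obtain ⟨s, hs⟩ := hex ψ
  refine ⟨LinearMap.toSpanSingleton B B s, fun a ha => ?_⟩
  rw [LinearMap.toSpanSingleton_apply, smul_eq_mul, ← sub_eq_zero]
  refine hzero _ fun r => ?_
  have h1 : ψ (r * a) = t (g ⟨r * a, I.mul_mem_left r ha⟩) :=
    congrArg (fun l => l ⟨r * a, I.mul_mem_left r ha⟩) hψ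
  have h2 : g ⟨r * a, I.mul_mem_left r ha⟩ = r * g ⟨a, ha⟩ := g.map_smul r ⟨a, ha⟩
  rw [mul_sub, map_sub, ← mul_assoc, hs, h1, h2, sub_self]

end SelfInjective

/-! ### Exactness and entries of the upper triangular matrices -/

section BidiagonalComplex

variable {B : Type*} [CommRing B]

/-- The matrix `[[a, c], [0, b]]`. -/
def upperMatrix (a b c : B) : Matrix (Fin 2) (Fin 2) B := !![a, c; 0, b]

theorem upperMatrix_mulVec (a b c : B) (v : Fin 2 → B) :
    (upperMatrix a b c).mulVecLin v = ![a * v 0 + c * v 1, b * v 1] := by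
  ext i
  fin_cases i <;> simp [upperMatrix, Matrix.mulVec, dotProduct, Fin.sum_univ_two]

theorem upperMatrix_exact {a b c c' : B} (ha : a * a = 0) (hb : b * b = 0)
    (hc : a * c' + b * c = 0) (ha' : ∀ r, a * r = 0 → ∃ s, r = a * s)
    (hb' : ∀ r, b * r = 0 → ∃ s, r = b * s) :
    Function.Exact (upperMatrix a b c').mulVecLin (upperMatrix a b c).mulVecLin := by
  intro v
  simp only [Set.mem_range, upperMatrix_mulVec]
  constructor
  · intro h
    have h0 := congrFun h 0
    have h1 := congrFun h 1
    simp only [Matrix.cons_val_zero, Matrix.cons_val_one, Pi.zero_apply] at h0 h1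
    obtain ⟨q, hq⟩ := hb' _ h1
    -- With `v 1 = b * q` and `b * c = -a * c'`, the first coordinate equation becomes `a * (v 0 -
    -- c' * q) = 0`.
    obtain ⟨p, hp⟩ := ha' (v 0 - c' * q) (by
      rw [hq] at h0
      linear_combination h0 - q * hc)
    refine ⟨![p, q], ?_⟩
    ext i
    fin_cases i
    · simp [← hp]
    · simp [hq]
  · rintro ⟨w, rfl⟩
    ext i
    fin_cases i
    · simp
      linear_combination w 0 * ha + w 1 * hc
    · simp
      linear_combination w 1 * hb

theorem minorsIdeal_upperMatrix (a b c : B) :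
    minorsIdeal 1 (upperMatrix a b c) = Ideal.span {c, a, b} := by
  rw [minorsIdeal, if_neg (by simp)]
  refine le_antisymm (Ideal.span_le.2 ?_) (Ideal.span_le.2 ?_)
  · rintro _ ⟨f, g, rfl⟩
    have h (i j : Fin 2) : upperMatrix a b c i j ∈ Ideal.span {c, a, b} := by
      fin_cases i <;> fin_cases j <;> simp [upperMatrix] <;> exact Ideal.subset_span (by simp)
    simpa using h (f 0) (g 0)
  · have h (i j : Fin 2) : ∃ (f g : Fin 1 ↪ Fin 2),
        upperMatrix a b c i j = ((upperMatrix a b c).submatrix f g).det :=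
      ⟨⟨fun _ => i, Function.injective_of_subsingleton _⟩,
        ⟨fun _ => j, Function.injective_of_subsingleton _⟩, by simp⟩
    rintro _ (rfl | rfl | rfl)
    · exact Ideal.subset_span (h 0 1)
    · exact Ideal.subset_span (h 0 0)
    · exact Ideal.subset_span (h 1 1)

end BidiagonalComplex

/-! ### Reducing a presentation modulo an element -/

section Augmentation

variable {A : Type*} [CommRing A] {m n : ℕ}

/-- The reduction modulo `t` of a presentation of a module. -/
theorem exists_augmentation_quotient (t : A) (D : Matrix (Fin m) (Fin n) A) :
    ∃ f : (Fin m → A ⧸ Ideal.span {t}) →ₗ[A ⧸ Ideal.span {t}]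
        (((Fin m → A) ⧸ LinearMap.range D.mulVecLin) ⧸
          t • (⊤ : Submodule A ((Fin m → A) ⧸ LinearMap.range D.mulVecLin))),
      Function.Surjective f ∧
        Function.Exact (D.map (Ideal.Quotient.mk (Ideal.span {t}))).mulVecLin f := by
  set π := Ideal.Quotient.mk (Ideal.span {t}) with hπ
  set N := LinearMap.range D.mulVecLin
  set P := t • (⊤ : Submodule A ((Fin m → A) ⧸ N))
  let f := Fintype.linearCombination (A ⧸ Ideal.span {t})
    (fun i : Fin m => P.mkQ (N.mkQ (Pi.single i 1)))
  have hf (w : Fin m → A) : f (fun i => π (w i)) = P.mkQ (N.mkQ w) := by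
    conv_rhs => rw [pi_eq_sum_univ' w, map_sum, map_sum]
    rw [Fintype.linearCombination_apply]
    refine Finset.sum_congr rfl fun i _ => ?_
    rw [map_smul, map_smul]
    rfl
  have hlift (v : Fin m → A ⧸ Ideal.span {t}) : ∃ w : Fin m → A, (fun i => π (w i)) = v := by
    choose w hw using fun i => Ideal.Quotient.mk_surjective (v i)
    exact ⟨w, funext hw⟩
  have hlift' (v : Fin n → A ⧸ Ideal.span {t}) : ∃ w : Fin n → A, (fun i => π (w i)) = v := by
    choose w hw using fun i => Ideal.Quotient.mk_surjective (v i)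
    exact ⟨w, funext hw⟩
  have hD (w : Fin n → A) :
      (D.map π).mulVecLin (fun i => π (w i)) = fun i => π (D.mulVecLin w i) := by
    ext i
    exact (RingHom.map_mulVec π D w i).symm
  refine ⟨f, fun y => ?_, fun v => ?_⟩
  · obtain ⟨z, rfl⟩ := P.mkQ_surjective y
    obtain ⟨w, rfl⟩ := N.mkQ_surjective z
    exact ⟨_, hf w⟩
  · obtain ⟨w, rfl⟩ := hlift v
    rw [hf, Submodule.mkQ_apply, Submodule.Quotient.mk_eq_zero,
      Submodule.mem_smul_pointwise_iff_exists]
    constructor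
    · rintro ⟨z, -, hz⟩
      obtain ⟨u, rfl⟩ := N.mkQ_surjective z
      rw [← map_smul, ← sub_eq_zero, ← map_sub, Submodule.mkQ_apply,
        Submodule.Quotient.mk_eq_zero] at hz
      obtain ⟨y, hy⟩ := hz
      refine ⟨fun i => π (-y i), ?_⟩
      rw [hD fun i => -y i]
      ext i
      have h1 : D.mulVecLin (fun i => -y i) = w - t • u := by
        rw [show (fun i => -y i) = -y from rfl, map_neg, hy, neg_sub]
      rw [h1, hπ, Ideal.Quotient.mk_eq_mk_iff_sub_mem]
      exact Ideal.mem_span_singleton.2 ⟨-u i, by simp⟩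
    · rintro ⟨y, hy⟩
      obtain ⟨y, rfl⟩ := hlift' y
      rw [hD] at hy
      have h1 (i) : ∃ u, w i - D.mulVecLin y i = t * u := by
        have := congrFun hy.symm i
        rwa [hπ, Ideal.Quotient.mk_eq_mk_iff_sub_mem, Ideal.mem_span_singleton] at this
      choose u hu using h1
      refine ⟨N.mkQ u, trivial, ?_⟩
      rw [← map_smul, ← sub_eq_zero, ← map_sub, Submodule.mkQ_apply,
        Submodule.Quotient.mk_eq_zero]
      refine ⟨-y, ?_⟩
      ext i
      rw [map_neg]
      simp only [Pi.neg_apply, Pi.sub_apply, Pi.smul_apply, smul_eq_mul]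
      linear_combination hu i

end Augmentation

/-! ### The resolution, and the Artinian and Gorenstein properties -/

namespace GasharovPeeva

namespace Model

variable {k : Type*} [Field k] {α : k}

instance injective_self : Module.Injective (Model α) (Model α) :=
  (Module.Baer.of_trace trace exists_trace_mul_eq fun _ => eq_zero_of_trace_mul).injective

/-- The entry `αⁱ x₃ + x₄` of the differentials. -/
def entry (α : k) (i : ℕ) : Model α := algebraMap k (Model α) (α ^ i) * gen 2 + gen 3

/-- The differentials `[[x₁, αⁱ x₃ + x₄], [0, x₂]]`. -/
def differential (α : k) (i : ℕ) : Matrix (Fin 2) (Fin 2) (Model α) :=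
  upperMatrix (gen 0) (gen 1) (entry α i)

/-- The ideals of entries of the differentials are pairwise different over a local ring over which
the differentials form an exact complex. -/
theorem resolution_of_surjective {B : Type*} [CommRing B] [IsLocalRing B]
    (hα : Function.Injective fun n : ℕ => α ^ n) (φ : Model α →+* B) (hφ : Function.Surjective φ)
    (h0 : ∀ r, φ (gen 0 * r) = 0 → ∃ s, φ r = φ (gen 0 * s))
    (h1 : ∀ r, φ (gen 1 * r) = 0 → ∃ s, φ r = φ (gen 1 * s))
    (hker : ∀ z, φ z = 0 → ∃ u, z = gen 4 * u)
    {M : Type*} [AddCommGroup M] [Module B M] (f : (Fin 2 → B) →ₗ[B] M)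
    (hf : Function.Surjective f) (hex : Function.Exact ((differential α 0).map φ).mulVecLin f) :
    Nonempty (MinimalFreeResolution B M) ∧ ∀ F : MinimalFreeResolution B M,
      ∀ i n : ℕ, 1 ≤ n → F.minors 1 i ≠ F.minors 1 (i + n) := by
  have hmap (i : ℕ) : (differential α i).map φ =
      upperMatrix (φ (gen 0)) (φ (gen 1)) (φ (entry α i)) := by
    ext a b
    fin_cases a <;> fin_cases b <;> simp [differential, upperMatrix]
  have hm {z : Model α} (hz : z.c0 = 0) : φ z ∈ IsLocalRing.maximalIdeal B := by
    obtain ⟨n, hn⟩ := (isNilpotent_of_c0_eq_zero hz).map φ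
    exact (IsLocalRing.maximalIdeal.isMaximal B).isPrime.mem_of_pow_mem n (hn ▸ zero_mem _)
  have hm0 : φ (gen 0) ∈ IsLocalRing.maximalIdeal B := hm rfl
  have hm1 : φ (gen 1) ∈ IsLocalRing.maximalIdeal B := hm rfl
  have hme (i : ℕ) : φ (entry α i) ∈ IsLocalRing.maximalIdeal B :=
    hm (by simp [entry, add_def, mul_def, gen2, gen3])
  -- `mat i` is the differential out of degree `i + 1`, so the entry ideal in degree `i + 1` carries
  -- exponent `i`.
  let G : MinimalFreeResolution B M :=
    { rank := fun _ => 2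
      mat := fun i => upperMatrix (φ (gen 0)) (φ (gen 1)) (φ (entry α i))
      augmentation := f
      augmentation_surjective := hf
      exact_zero := hmap 0 ▸ hex
      exact_succ := fun i => by
        refine upperMatrix_exact ?_ ?_ ?_ (fun r hr => ?_) (fun r hr => ?_)
        · rw [← map_mul, gen_zero_mul_self, map_zero]
        · rw [← map_mul, gen_one_mul_self, map_zero]
        · rw [← map_mul, ← map_mul, ← map_add, entry, entry, pow_succ, gen_mul_add_gen_mul,
            map_zero]
        · obtain ⟨r, rfl⟩ := hφ r
          rw [← map_mul] at hr
          obtain ⟨s, hs⟩ := h0 r hr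
          exact ⟨φ s, by rw [hs, map_mul]⟩
        · obtain ⟨r, rfl⟩ := hφ r
          rw [← map_mul] at hr
          obtain ⟨s, hs⟩ := h1 r hr
          exact ⟨φ s, by rw [hs, map_mul]⟩
      minimal := fun i a b => by
        fin_cases a <;> fin_cases b <;> simp only [upperMatrix, Fin.zero_eta, Fin.mk_one,
          Matrix.of_apply, Matrix.cons_val_zero, Matrix.cons_val_one]
        exacts [hm0, hme i, zero_mem _, hm1] }
  have hG (i : ℕ) : G.minors 1 (i + 1) = Ideal.span {φ (entry α i), φ (gen 0), φ (gen 1)} :=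
    minorsIdeal_upperMatrix _ _ _
  refine ⟨⟨G⟩, fun F i n hn h => ?_⟩
  rw [F.minors_one_eq G, F.minors_one_eq G] at h
  obtain ⟨n, rfl⟩ := Nat.exists_eq_add_of_le' hn
  rw [← add_assoc, hG] at h
  cases i with
  | zero =>
    -- In degree 0 the convention gives the unit ideal, while all later entry ideals are proper.
    have htop : G.minors 1 0 = ⊤ := by simp [MinimalFreeResolution.minors, minorsIdeal]
    rw [htop] at h
    refine (IsLocalRing.maximalIdeal.isMaximal B).ne_top (top_le_iff.1 (h.trans_le ?_))
    refine Ideal.span_le.2 ?_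
    rintro _ (rfl | rfl | rfl)
    exacts [hme _, hm0, hm1]
  | succ i =>
    rw [hG] at h
    have hmem : φ (entry α i) ∈
        Ideal.span {φ (entry α (i + 1 + n)), φ (gen 0), φ (gen 1)} :=
      h ▸ Ideal.subset_span (by simp)
    obtain ⟨r, z, hz, hr⟩ := Ideal.mem_span_insert.1 hmem
    obtain ⟨p, q, rfl⟩ := Ideal.mem_span_pair.1 hz
    obtain ⟨r, rfl⟩ := hφ r
    obtain ⟨p, rfl⟩ := hφ p
    obtain ⟨q, rfl⟩ := hφ q
    rw [← map_mul, ← map_mul, ← map_mul, ← map_add, ← map_add, ← sub_eq_zero, ← map_sub] at hr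
    obtain ⟨u, hu⟩ := hker _ hr
    have := hα (eq_of_eq_combination hu)
    omega

end Model

variable {k : Type*} [Field k] (α : k)

theorem isArtinianRing_R : IsArtinianRing (R α) :=
  have : IsArtinianRing (Model α) := IsArtinianRing.of_finite k (Model α)
  (Model.equivR α).surjective.isArtinianRing

theorem isGorensteinLocalRing_R : IsGorensteinLocalRing (R α) where
  isLocalRing := inferInstance
  isNoetherianRing :=
    have := isArtinianRing_R α
    inferInstance
  finite_injectiveDimension := by
    -- `R` is injective over itself, so its injective dimension is at most 0.
    refine ⟨0, ?_⟩
    have h : Module.Injective (R α) (R α) :=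
      Module.Injective.of_ringEquiv (Model.equivR α) (Model.equivR α).toSemilinearEquiv
    have := (Module.injective_iff_injective_object (R α) (R α)).1 h
    exact inferInstanceAs (CategoryTheory.HasInjectiveDimensionLT (ModuleCat.of (R α) (R α)) 1)

end GasharovPeeva

/-! ### The module and its reduction modulo `x₅` -/

/-- `M` is one module for both parts.  The ideals `I^1_i` of a module are the ideals of minors of
its minimal free resolution; the claim includes that a minimal free resolution exists, and is made
for every one of them. -/
theorem mainTheorem12 (k : Type u) [Field k] (α : kˣ) (hα : ¬ IsOfFinOrder α) :
    IsArtinianRing (GasharovPeeva.R (α : k)) ∧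
    IsGorensteinLocalRing (GasharovPeeva.R (α : k)) ∧
    ∃ (M : Type u) (_ : AddCommGroup M) (_ : Module (GasharovPeeva.R (α : k)) M),
      Module.Finite (GasharovPeeva.R (α : k)) M ∧
      (Nonempty (MinimalFreeResolution (GasharovPeeva.R (α : k)) M) ∧
        ∀ F : MinimalFreeResolution (GasharovPeeva.R (α : k)) M,
          ∀ i n : ℕ, 1 ≤ n → F.minors 1 i ≠ F.minors 1 (i + n)) ∧
      (Nonempty (MinimalFreeResolution
          (GasharovPeeva.R (α : k) ⧸ Ideal.span {GasharovPeeva.x₅ (α : k)})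
          (M ⧸ GasharovPeeva.x₅ (α : k) • (⊤ : Submodule (GasharovPeeva.R (α : k)) M))) ∧
        ∀ F : MinimalFreeResolution
          (GasharovPeeva.R (α : k) ⧸ Ideal.span {GasharovPeeva.x₅ (α : k)})
          (M ⧸ GasharovPeeva.x₅ (α : k) • (⊤ : Submodule (GasharovPeeva.R (α : k)) M)),
          ∀ i n : ℕ, 1 ≤ n → F.minors 1 i ≠ F.minors 1 (i + n)) := by
  refine ⟨GasharovPeeva.isArtinianRing_R _, GasharovPeeva.isGorensteinLocalRing_R _, ?_⟩
  have hα0 : (α : k) ≠ 0 := α.ne_zero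
  have hpow : Function.Injective fun n : ℕ => (α : k) ^ n := fun m n h =>
    injective_pow_iff_not_isOfFinOrder.2 hα (Units.ext (by simpa using h))
  let e := GasharovPeeva.Model.equivR (α : k)
  let D : Matrix (Fin 2) (Fin 2) (GasharovPeeva.R (α : k)) := (GasharovPeeva.Model.differential (α : k) 0).map e
  refine ⟨(Fin 2 → GasharovPeeva.R (α : k)) ⧸ LinearMap.range D.mulVecLin, inferInstance, inferInstance,
    inferInstance, ?_, ?_⟩
  · refine GasharovPeeva.Model.resolution_of_surjective hpow (e : GasharovPeeva.Model (α : k) →+* GasharovPeeva.R (α : k)) e.surjective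
      (fun r hr => ?_) (fun r hr => ?_) (fun z hz => ?_)
      (LinearMap.range D.mulVecLin).mkQ (Submodule.mkQ_surjective _)
      (LinearMap.exact_map_mkQ_range _)
    · obtain ⟨s, hs⟩ := GasharovPeeva.Model.exists_of_gen0_mul (e.map_eq_zero_iff.1 hr)
      exact ⟨s, congrArg e hs⟩
    · obtain ⟨s, hs⟩ := GasharovPeeva.Model.exists_of_gen1_mul hα0 (e.map_eq_zero_iff.1 hr)
      exact ⟨s, congrArg e hs⟩
    · exact ⟨0, by rw [e.map_eq_zero_iff.1 hz, mul_zero]⟩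
  · obtain ⟨f, hf, hex⟩ := exists_augmentation_quotient (GasharovPeeva.x₅ (α : k)) D
    let π := Ideal.Quotient.mk (Ideal.span {GasharovPeeva.x₅ (α : k)})
    have hgen : e (GasharovPeeva.Model.gen 4) = GasharovPeeva.x₅ (α : k) := GasharovPeeva.Model.equivR_gen 4
    have hπ (u : GasharovPeeva.Model (α : k)) : π (e (GasharovPeeva.Model.gen 4 * u)) = 0 := by
      rw [map_mul, hgen]
      exact Ideal.Quotient.eq_zero_iff_mem.2 (Ideal.mem_span_singleton.2 ⟨_, rfl⟩)
    have hker (z : GasharovPeeva.Model (α : k)) (hz : π (e z) = 0) : ∃ u, z = GasharovPeeva.Model.gen 4 * u := by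
      obtain ⟨u, hu⟩ := Ideal.mem_span_singleton.1 (Ideal.Quotient.eq_zero_iff_mem.1 hz)
      obtain ⟨u, rfl⟩ := e.surjective u
      rw [← hgen, ← map_mul] at hu
      exact ⟨u, e.injective hu⟩
    refine GasharovPeeva.Model.resolution_of_surjective hpow (π.comp (e : GasharovPeeva.Model (α : k) →+* GasharovPeeva.R (α : k)))
      (Ideal.Quotient.mk_surjective.comp e.surjective)
      (fun r hr => ?_) (fun r hr => ?_) hker f hf hex
    -- Vanishing in the quotient is lifted to an equation with a multiple of `x₅` in the model,
    -- where the annihilator computation modulo `x₅` applies.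
    · obtain ⟨u, hu⟩ := hker _ hr
      obtain ⟨s, t, hs⟩ := GasharovPeeva.Model.exists_of_gen0_mul_eq hu
      refine ⟨s, ?_⟩
      change π (e r) = π (e (GasharovPeeva.Model.gen 0 * s))
      rw [hs, map_add, map_add, hπ, add_zero]
    · obtain ⟨u, hu⟩ := hker _ hr
      obtain ⟨s, t, hs⟩ := GasharovPeeva.Model.exists_of_gen1_mul_eq hα0 hu
      refine ⟨s, ?_⟩
      change π (e r) = π (e (GasharovPeeva.Model.gen 1 * s))
      rw [hs, map_add, map_add, hπ, add_zero]
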